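/- Let $K$ be an algebraically closed field of characteristic zero and let $H$ be a semisimple Hopf algebra over $K$ of finite dimension $n$, with multiplication $m$, comultiplication $\Delta$, counit $\varepsilon$ and antipode $S$. Let $\Lambda\in H$ be the integral of $H$ (that is, $h\Lambda=\varepsilon(h)\Lambda$ for all $h\in H$) normalized by $\varepsilon(\Lambda)=n$, and put $\nu=\sum_{(\Lambda)}\Lambda_1\otimes S(\Lambda_2)\in H\otimes_K H$. For a subring $R\subseteq K$, a weak $R$-form of $H$ is a free $R$-submodule $H_R\subseteq H$ with an $R$-basis $x_1,\dots,x_n$ that is also a $K$-basis of $H$ and for which all the coefficients $m_{i,j}^k$ and $\nu^{i,j}$, defined by $x_ix_j=\sum_k m_{i,j}^k x_k$ and $\nu=\sum_{i,j}\nu^{i,j}\,x_i\otimes x_j$, belong to $R$. Let $\mathbb{A}\subseteq K$ be the ring of algebraic integers, i.e. of the elements of $K$ integral over $\mathbb{Z}$. Suppose that there is a family $(R_i)_{i}$ of subrings of $K$, each a unique factorization domain, such that $H$ admits a weak $R_i$-form for each $i$ and $\bigcap_i R_i\subseteq\mathbb{A}$. Then $H$ is of Frobenius type: for every irreducible representation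 $M$ of $H$, $\dim_K M$ divides $n$. -/

import Mathlib

universe u v w t

noncomputable section HopfWeakForms

open scoped TensorProduct

/-- `Λ` is a (left) integral of the Hopf algebra `H`: `h Λ = ε(h) Λ` for all `h`. In a finite
dimensional semisimple Hopf algebra left and right integrals coincide. -/
def IsHopfIntegral (K : Type u) (H : Type v) [Field K] [Ring H] [HopfAlgebra K H]
    (Λ : H) : Prop :=
  ∀ h : H, h * Λ = Coalgebra.counit (R := K) h • Λ

/-- The integral `Λ` normalized by `ε(Λ) = n = dim H`. (In a semisimple Hopf algebra in
characteristic zero there is exactly one such element.) -/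
def IsNormalizedHopfIntegral (K : Type u) (H : Type v) [Field K] [Ring H] [HopfAlgebra K H]
    (Λ : H) : Prop :=
  IsHopfIntegral K H Λ ∧ Coalgebra.counit (R := K) Λ = (Module.finrank K H : K)

/-- The tensor `ν = ∑ Λ₁ ⊗ S(Λ₂)`. -/
def hopfNu (K : Type u) (H : Type v) [Field K] [Ring H] [HopfAlgebra K H]
    (Λ : H) : H ⊗[K] H :=
  (HopfAlgebra.antipode K).lTensor H (Coalgebra.comul (R := K) Λ)

/-- The `R`-submodule `L` of `H` is a weak `R`-form of `H`, i.e. an `R`-form of `(H, m, ν)`: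
it is the `R`-span of a `K`-basis `x₁, …, xₙ` of `H` (which is then an `R`-basis of `L`) in which
the structure constants of `m` and the coefficients of `ν` belong to `R`. -/
def IsWeakHopfForm (K : Type u) (H : Type v) [Field K] [Ring H] [HopfAlgebra K H]
    (R : Subring K) (L : Submodule R H) : Prop :=
  ∃ Λ : H, IsNormalizedHopfIntegral K H Λ ∧
    ∃ x : Module.Basis (Fin (Module.finrank K H)) K H,
      L = Submodule.span R (Set.range x) ∧
      (∀ i j k, x.repr (x i * x j) k ∈ R) ∧
      (∀ i j, (x.tensorProduct x).repr (hopfNu K H Λ) (i, j) ∈ R)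

/-- `H` admits a weak `R`-form. -/
def AdmitsWeakHopfForm (K : Type u) (H : Type v) [Field K] [Ring H] [HopfAlgebra K H]
    (R : Subring K) : Prop :=
  ∃ L : Submodule R H, IsWeakHopfForm K H R L

/-- `H` is of Frobenius type: the dimension of every irreducible representation of `H`
divides the dimension of `H`. -/
def IsFrobeniusType (K : Type u) (H : Type v) [Field K] [Ring H] [HopfAlgebra K H] : Prop :=
  ∀ (M : Type w) [AddCommGroup M] [Module K M] [Module H M] [IsScalarTower K H M],
    IsSimpleModule H M → Module.finrank K M ∣ Module.finrank K H

end HopfWeakForms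

/-! ### Antipode identities and moving factors across the coproduct of the integral -/

section Sweedler

open scoped TensorProduct
open Coalgebra HopfAlgebra

variable {K : Type u} {H : Type v} [Field K] [Ring H] [HopfAlgebra K H]

/-! The tensor `ν` satisfies `(h ⊗ 1) ν = ν (1 ⊗ h)`, `ν (h ⊗ 1) = (1 ⊗ S² h) ν` and `m(ν) = n`. On
`M ⊗ M`, with `M` irreducible of dimension `d`, the first identity makes `ν` act as `(1 ⊗ c)` times
the flip, the second makes `c` intertwine `ρ` with `ρ ∘ S²`, and the third gives `tr c = n`. Once
`S² = id`, Schur's lemma yields `c = n/d`, so `n/d` is an eigenvalue of `ν`. In a weak `R`-form,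
left multiplication by `ν` on `H ⊗ H` has a matrix over `R`, so `n/d` is integral over `R`; as a UFD
is integrally closed, `n/d ∈ R`. Lying in every `R i`, it is a rational algebraic integer, hence an
integer.

The bulk of the work is `S² = id` (`antipode_antipode_of_semisimple`). The matrices `c_χ` are
invertible, and `λ = ∑ tr(c_χ⁻¹ ρ_χ)` is a Frobenius form dual to `ν`. Radford's formula expresses
`S⁴` as conjugation by a group-like element, so `S²` has finite order. Trace formulas give `tr S² =
n λ(1)` and `tr(S² E) = λ(1)`, where `E` is an idempotent commuting with `S²`, namely convolution
with the normalized regular character. Moreover `n λ(1) = ∑ tr(c_χ) tr(c_χ⁻¹)` is nonzero, being a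
sum of squared absolute values. Thus the average of the `n` eigenvalues of `S²` is a nonzero
algebraic integer; by Kronecker's theorem they all coincide (`pow_eq_of_average_integral`), and `S²
1 = 1` forces the common value to be 1. -/

theorem antipode_mul_eq (x y : H) : antipode K (x * y) = antipode K y * antipode K x :=
  antipode_mul_antidistrib x y

/-- Coassociativity and the antipode axiom in the form `S(h₁) h₂ ⊗ h₃ = 1 ⊗ h`. -/
theorem sum_antipode_tmul_one_mul_comul {ι : Type*} {h : H} (r : Repr K h ι) :
    ∑ i ∈ r.index, (antipode K (r.left i) ⊗ₜ[K] (1 : H)) * comul (R := K) (r.right i) = 1 ⊗ₜ h := by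
  let T : H ⊗[K] (H ⊗[K] H) →ₗ[K] H ⊗[K] H :=
    (LinearMap.mul' K H ∘ₗ
      (antipode K (A := H)).rTensor H).rTensor H ∘ₗ (TensorProduct.assoc K H H H).symm
  have hT (x : H) (t : H ⊗[K] H) : T (x ⊗ₜ t) = (antipode K x ⊗ₜ[K] (1 : H)) * t := by
    induction t using TensorProduct.induction_on with
    | zero => simp
    | tmul y z => simp [T]
    | add a b ha hb => rw [TensorProduct.tmul_add, map_add, ha, hb, mul_add]
  have h1 : T ((comul (R := K) (A := H)).lTensor H (comul (R := K) h)) = 1 ⊗ₜ h := by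
    have : T ((comul (R := K) (A := H)).lTensor H (comul (R := K) h)) =
        ((LinearMap.mul' K H ∘ₗ (antipode K (A := H)).rTensor H ∘ₗ comul).rTensor H) (comul (R :=
            K) h) := by
      simp only [T, LinearMap.comp_apply, LinearEquiv.coe_coe, coassoc_symm_apply,
        LinearMap.rTensor_comp_apply]
    rw [this, mul_antipode_rTensor_comul, LinearMap.rTensor_comp_apply, rTensor_counit_comul]
    simp
  rw [← h1, ← r.eq]
  simp [hT]

theorem sum_comul_mul_one_tmul_antipode {ι : Type*} {h : H} (r : Repr K h ι) :
    ∑ i ∈ r.index, comul (R := K) (r.left i) * ((1 : H) ⊗ₜ[K] antipode K (r.right i)) = h ⊗ₜ 1 := by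
  let T : (H ⊗[K] H) ⊗[K] H →ₗ[K] H ⊗[K] H :=
    (LinearMap.mul' K H ∘ₗ
      (antipode K (A := H)).lTensor H).lTensor H ∘ₗ (TensorProduct.assoc K H H H)
  have hT (x : H) (t : H ⊗[K] H) : T (t ⊗ₜ x) = t * ((1 : H) ⊗ₜ[K] antipode K x) := by
    induction t using TensorProduct.induction_on with
    | zero => simp
    | tmul y z => simp [T]
    | add a b ha hb => rw [TensorProduct.add_tmul, map_add, ha, hb, add_mul]
  have h1 : T ((comul (R := K) (A := H)).rTensor H (comul (R := K) h)) = h ⊗ₜ 1 := by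
    have : T ((comul (R := K) (A := H)).rTensor H (comul (R := K) h)) =
        ((LinearMap.mul' K H ∘ₗ (antipode K (A := H)).lTensor H ∘ₗ comul).lTensor H) (comul (R :=
            K) h) := by
      simp only [T, LinearMap.comp_apply, LinearEquiv.coe_coe, coassoc_apply,
        LinearMap.lTensor_comp_apply]
    rw [this, mul_antipode_lTensor_comul, LinearMap.lTensor_comp_apply, lTensor_counit_comul]
    simp
  rw [← h1, ← r.eq]
  simp [hT]

open WithConv in
/-- The antipode is an anti-coalgebra map. -/
theorem comul_antipode (h : H) :
    comul (R := K) (antipode K h) = TensorProduct.map (antipode K (A := H))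
      (antipode K (A := H)) (TensorProduct.comm K H H (comul (R := K) h)) := by
  let G : H →ₗ[K] H ⊗[K] H := TensorProduct.map (antipode K (A := H))
      (antipode K (A := H)) ∘ₗ (TensorProduct.comm K H H).toLinearMap ∘ₗ comul
  suffices toConv G = toConv (comul ∘ₗ (antipode K (A := H))) from
    (congr($(toConv_injective this) h)).symm
  -- Both maps are convolution inverses of `Δ` in `Hom(H, H ⊗ H)`.
  refine left_inv_eq_right_inv (a := toConv (comul (R := K) (A := H))) ?_ LinearMap.comul_right_inv
  apply WithConv.ext
  ext h
  let T : H ⊗[K] (H ⊗[K] H) →ₗ[K] H ⊗[K] H :=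
    (LinearMap.mul' K (H ⊗[K] H)) ∘ₗ TensorProduct.map
      (TensorProduct.map (antipode K (A := H))
      (antipode K (A := H)) ∘ₗ (TensorProduct.comm K H H).toLinearMap) (comul) ∘ₗ
      (TensorProduct.assoc K H H H).symm.toLinearMap
  have h1 : ((toConv G * toConv (comul (R := K) (A := H)) : WithConv (H →ₗ[K] H ⊗[K] H)).ofConv) h =
      T ((comul (R := K) (A := H)).lTensor H (comul (R := K) h)) := by
    simp only [T, LinearMap.comp_apply, LinearEquiv.coe_coe, coassoc_symm_apply,
      LinearMap.convMul_def, ofConv_toConv, G, LinearMap.rTensor]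
    rw [← LinearMap.comp_apply (TensorProduct.map _ _) (TensorProduct.map _ _),
      ← TensorProduct.map_comp]
    simp [LinearMap.comp_assoc]
  have h2 (x y : H) : T (x ⊗ₜ comul (R := K) y) = (1 : H) ⊗ₜ (antipode K x * y) := by
    have : T (x ⊗ₜ comul (R := K) y) = ((1 : H) ⊗ₜ[K] antipode K x) * (1 ⊗ₜ y) := by
      rw [← sum_antipode_tmul_one_mul_comul (ℛ K y), Finset.mul_sum, ← (ℛ K y).eq]
      simp [T, TensorProduct.tmul_sum, ← mul_assoc]
    rw [this]; simp
  have h3 : T ((comul (R := K) (A := H)).lTensor H (comul (R := K) h)) =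
      (1 : H) ⊗ₜ[K] (LinearMap.mul' K H ((antipode K (A := H)).rTensor H (comul (R := K) h))) := by
    rw [← (ℛ K h).eq]
    simp [h2, TensorProduct.tmul_sum]
  change ((toConv G * toConv (comul (R := K) (A := H)) : WithConv (H →ₗ[K] H ⊗[K] H)).ofConv) h = _
  rw [h1, h3, mul_antipode_rTensor_comul_apply]
  simp [Algebra.algebraMap_eq_smul_one, Algebra.TensorProduct.one_def]

theorem comul_antipode_antipode (h : H) :
    comul (R := K) (antipode K (antipode K h)) =
        TensorProduct.map (antipode K ∘ₗ antipode K (A := H)) (antipode K ∘ₗ antipode K (A :=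
            H)) (comul (R := K) h) := by
  rw [comul_antipode, comul_antipode]
  generalize comul (R := K) h = t
  induction t using TensorProduct.induction_on with
  | zero => simp
  | tmul y z => simp
  | add a b ha hb => simp only [map_add, ha, hb]

theorem lTensor_antipode_tmul_mul (x y : H) (s : H ⊗[K] H) :
    (antipode K (A := H)).lTensor H ((x ⊗ₜ y) * s) = (x ⊗ₜ 1) *
      (antipode K (A := H)).lTensor H s * (1 ⊗ₜ antipode K y) := by
  induction s using TensorProduct.induction_on with
  | zero => simp
  | tmul a b => simp [antipode_mul_eq]
  | add a b ha hb => simp only [map_add, ha, hb, mul_add, add_mul]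

theorem lTensor_antipode_mul_tmul (x y : H) (s : H ⊗[K] H) :
    (antipode K (A := H)).lTensor H (s * (x ⊗ₜ y)) = (1 ⊗ₜ antipode K y) *
      (antipode K (A := H)).lTensor H s * (x ⊗ₜ 1) := by
  induction s using TensorProduct.induction_on with
  | zero => simp
  | tmul a b => simp [antipode_mul_eq]
  | add a b ha hb => simp only [map_add, ha, hb, mul_add, add_mul]

variable {Λ : H}

/-- Moving a factor across the coproduct of a left integral. -/
theorem one_tmul_mul_comul_integral (hΛ : ∀ h : H, h * Λ = counit (R := K) h • Λ) (h : H) :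
    ((1 : H) ⊗ₜ[K] h) * comul (R := K) Λ = (antipode K h ⊗ₜ 1) * comul (R := K) Λ := by
  rw [← sum_antipode_tmul_one_mul_comul (ℛ K h), Finset.sum_mul]
  simp only [mul_assoc, ← Bialgebra.comul_mul, hΛ, map_smul]
  have h2 := congr(TensorProduct.rid K H (
      (antipode K (A := H)).rTensor K $(sum_tmul_counit_eq (ℛ K h))))
  simp only [map_sum, LinearMap.rTensor_tmul, TensorProduct.rid_tmul, one_smul] at h2
  rw [← h2, TensorProduct.sum_tmul, Finset.sum_mul]
  simp [← TensorProduct.smul_tmul']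

/-- Moving a factor across the coproduct of a right integral. -/
theorem comul_integral_mul_tmul_one (hΛ : ∀ h : H, Λ * h = counit (R := K) h • Λ) (h : H) :
    comul (R := K) Λ * (h ⊗ₜ[K] (1 : H)) = comul (R := K) Λ * (1 ⊗ₜ antipode K h) := by
  rw [← sum_comul_mul_one_tmul_antipode (ℛ K h), Finset.mul_sum]
  simp only [← mul_assoc, ← Bialgebra.comul_mul, hΛ, map_smul]
  conv_rhs => rw [← sum_counit_smul (ℛ K h)]
  simp [TensorProduct.tmul_sum, Finset.mul_sum]

/-- `(h ⊗ 1) ν = ν (1 ⊗ h)`. -/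
theorem tmul_one_mul_hopfNu (hΛ : ∀ h : H, h * Λ = counit (R := K) h • Λ) (h : H) :
    (h ⊗ₜ[K] (1 : H)) * hopfNu K H Λ = hopfNu K H Λ * (1 ⊗ₜ h) := by
  let ν := hopfNu K H Λ
  -- The element `(h₁ ⊗ 1) ν (1 ⊗ S(h₂) h₃)` is evaluated in two ways: contracting `S(h₂) h₃` gives
  -- the left side, while grouping `h₁, h₂` into `Δ(h₁)` lets the integral absorb them and gives the
  -- right side.
  let W : H ⊗[K] H →ₗ[K] H ⊗[K] H := TensorProduct.lift
    (LinearMap.mk₂ K (fun x y => (x ⊗ₜ[K] (1 : H)) * ν * (1 ⊗ₜ[K] y))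
      (by intros; simp [TensorProduct.add_tmul, add_mul])
      (by intros; simp [← TensorProduct.smul_tmul'])
      (by intros; simp [TensorProduct.tmul_add, mul_add])
      (by intros; simp))
  let V : H ⊗[K] (H ⊗[K] H) →ₗ[K] H ⊗[K] H := W ∘ₗ (LinearMap.mul' K H ∘ₗ
      (antipode K (A := H)).rTensor H).lTensor H
  have h1 : V ((comul (R := K) (A := H)).lTensor H (comul (R := K) h)) = (h ⊗ₜ[K] (1 : H)) * ν := by
    have : V ((comul (R := K) (A := H)).lTensor H (comul (R := K) h)) =
        W (((LinearMap.mul' K H ∘ₗ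
      (antipode K (A := H)).rTensor H ∘ₗ comul).lTensor H) (comul (R := K) h)) := by
      simp only [V, LinearMap.comp_apply, LinearMap.lTensor_comp_apply]
    rw [this, mul_antipode_rTensor_comul, LinearMap.lTensor_comp_apply, lTensor_counit_comul]
    simp [W, ← Algebra.TensorProduct.one_def]
  have h2 (t : H ⊗[K] H) (z : H) : V (TensorProduct.assoc K H H H (t ⊗ₜ z)) =
      (antipode K (A := H)).lTensor H (t * comul (R := K) Λ) * (1 ⊗ₜ z) := by
    induction t using TensorProduct.induction_on with
    | zero => simp
    | tmul x y =>
      rw [lTensor_antipode_tmul_mul, mul_assoc _ (1 ⊗ₜ antipode K y)]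
      simp [V, W, ν, hopfNu]
    | add a b ha hb => simp only [TensorProduct.add_tmul, map_add, ha, hb, add_mul]
  change _ = ν * _
  rw [← h1, ← coassoc_apply]
  conv_lhs => rw [← (ℛ K h).eq]
  simp only [map_sum, LinearMap.rTensor_tmul, h2, ← Bialgebra.comul_mul, hΛ, map_smul]
  conv_rhs => rw [← sum_counit_smul (ℛ K h)]
  simp [TensorProduct.tmul_sum, Finset.mul_sum, ν, hopfNu]

/-- `ν (h ⊗ 1) = (1 ⊗ S² h) ν`. -/
theorem hopfNu_mul_tmul_one (hΛ : ∀ h : H, Λ * h = counit (R := K) h • Λ) (h : H) :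
    hopfNu K H Λ * (h ⊗ₜ[K] (1 : H)) = (1 ⊗ₜ antipode K (antipode K h)) * hopfNu K H Λ := by
  have := congr((antipode K (A := H)).lTensor H $(comul_integral_mul_tmul_one hΛ h))
  rw [lTensor_antipode_mul_tmul, lTensor_antipode_mul_tmul] at this
  simpa [hopfNu, ← Algebra.TensorProduct.one_def] using this

theorem mul_hopfNu (Λ : H) :
    LinearMap.mul' K H (hopfNu K H Λ) = algebraMap K H (counit (R := K) Λ) :=
  mul_antipode_lTensor_comul_apply Λ

end Sweedler

/-! ### The action of a Casimir tensor on products of matrix representations -/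

section CasimirTensor

open scoped TensorProduct Kronecker

variable {K : Type u} {A : Type v} [Field K] [Ring A] [Algebra K A]

/-- The representation of `A ⊗ A` on a tensor product of two matrix representations of `A`. -/
noncomputable def kroneckerRep {m n : ℕ} (ρ : A →ₐ[K] Matrix (Fin m) (Fin m) K)
    (σ : A →ₐ[K] Matrix (Fin n) (Fin n) K) :
    A ⊗[K] A →ₐ[K] Matrix (Fin m × Fin n) (Fin m × Fin n) K :=
  Algebra.TensorProduct.algHomOfLinearMapTensorProduct
    ((kroneckerLinearEquiv _ _ _ _ K).toLinearMap ∘ₗ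
      TensorProduct.map ρ.toLinearMap σ.toLinearMap)
    (by intros; simp [Matrix.mul_kronecker_mul]) (by simp)

variable {m n : ℕ} {ρ : A →ₐ[K] Matrix (Fin m) (Fin m) K} {σ : A →ₐ[K] Matrix (Fin n) (Fin n) K}

theorem kroneckerRep_tmul (a b : A) : kroneckerRep ρ σ (a ⊗ₜ b) = ρ a ⊗ₖ σ b := rfl

variable {ν : A ⊗[K] A} {s : A → A}

/-- The Casimir identity at an element acting as 1 on one factor and as 0 on the other. -/
theorem kroneckerRep_eq_zero_of_separated (h1 : ∀ h, (h ⊗ₜ 1) * ν = ν * (1 ⊗ₜ h))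
    {e : A} (hρ : ρ e = 1) (hσ : σ e = 0) : kroneckerRep ρ σ ν = 0 := by
  have := congr(kroneckerRep ρ σ $(h1 e))
  simpa [kroneckerRep_tmul, hρ, hσ] using this

/-- By surjectivity the Casimir identity can be tested on matrix units; it leaves only tensors of
the form `(1 ⊗ c)` times the flip. -/
theorem exists_kroneckerRep_eq (h1 : ∀ h, (h ⊗ₜ 1) * ν = ν * (1 ⊗ₜ h))
    (hρ : Function.Surjective ρ) :
    ∃ c : Matrix (Fin m) (Fin m) K, ∀ i k j l,
      kroneckerRep ρ ρ ν (i, k) (j, l) = if i = l then c k j else 0 := by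
  have key (p q i k j l : Fin m) :
      (if i = p then kroneckerRep ρ ρ ν (q, k) (j, l) else 0) =
        if q = l then kroneckerRep ρ ρ ν (i, k) (j, p) else 0 := by
    obtain ⟨h, hh⟩ := hρ (Matrix.single p q 1)
    have := congr(kroneckerRep ρ ρ $(h1 h) (i, k) (j, l))
    simpa [kroneckerRep_tmul, hh, Matrix.mul_apply, Fintype.sum_prod_type, Matrix.one_apply,
      Matrix.single_apply, ite_and, eq_comm] using this
  refine ⟨fun k j => kroneckerRep ρ ρ ν (k, k) (j, k), fun i k j l => ?_⟩
  split_ifs with h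
  · subst h
    simpa using key k i k k j i
  · simpa [h] using (key l l i k j l).symm

variable {c : Matrix (Fin m) (Fin m) K}

theorem intertwine_of_kroneckerRep_eq (h2 : ∀ h, ν * (h ⊗ₜ 1) = (1 ⊗ₜ s h) * ν)
    (hc : ∀ i k j l, kroneckerRep ρ ρ ν (i, k) (j, l) = if i = l then c k j else 0) (h : A) :
    c * ρ h = ρ (s h) * c := by
  ext k j
  have := congr(kroneckerRep ρ ρ $(h2 h) (k, k) (j, k))
  simpa [kroneckerRep_tmul, Matrix.mul_apply, Fintype.sum_prod_type, Matrix.one_apply,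
      hc] using this

theorem mul'_apply_eq_sum_kroneckerRep (t : A ⊗[K] A) (i l : Fin m) :
    ρ (LinearMap.mul' K A t) i l = ∑ j, kroneckerRep ρ ρ t (i, j) (j, l) := by
  induction t using TensorProduct.induction_on with
  | zero => simp
  | tmul a b => simp [kroneckerRep_tmul, Matrix.mul_apply]
  | add a b ha hb => simp [ha, hb, Finset.sum_add_distrib]

theorem trace_of_kroneckerRep_eq [NeZero m] {N : K}
    (h3 : LinearMap.mul' K A ν = algebraMap K A N)
    (hc : ∀ i k j l, kroneckerRep ρ ρ ν (i, k) (j, l) = if i = l then c k j else 0) :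
    c.trace = N := by
  have := mul'_apply_eq_sum_kroneckerRep (ρ := ρ) ν 0 0
  rw [h3, AlgHom.commutes] at this
  simpa [hc, Matrix.algebraMap_matrix_apply, Matrix.trace] using this.symm

/-- Schur's argument: the kernel of `c` is stable under the full matrix algebra, so it is zero
unless `c = 0`. -/
theorem isUnit_of_intertwine (hρ : Function.Surjective ρ)
    (hc : ∀ h, c * ρ h = ρ (s h) * c) (hne : c ≠ 0) : IsUnit c := by
  rw [← Matrix.mulVec_injective_iff_isUnit, ← Matrix.coe_mulVecLin, ← LinearMap.ker_eq_bot,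
      LinearMap.ker_eq_bot']
  intro x hx
  by_contra hx0
  obtain ⟨i, hi⟩ := Function.ne_iff.mp hx0
  apply hne
  ext k j
  obtain ⟨h, hh⟩ := hρ (Matrix.single j i 1)
  have := congr(Matrix.mulVec $(hc h) x k)
  rw [← Matrix.mulVec_mulVec, ← Matrix.mulVec_mulVec, hh] at this
  rw [show c.mulVec x = 0 from hx] at this
  rw [Matrix.single_mulVec] at this
  simpa [Matrix.mulVec, dotProduct, Function.update_apply,
    show x i ≠ 0 from hi] using this

end CasimirTensor

/-! ### The Frobenius form dual to a Casimir tensor -/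

section FrobeniusForm

open scoped TensorProduct Kronecker

variable {K : Type u} {A : Type v} [Field K] [Ring A] [Algebra K A]

/-- Contraction of the second tensor factor against a linear form. -/
noncomputable def contractSnd (f : A →ₗ[K] K) : A ⊗[K] A →ₗ[K] A :=
  (TensorProduct.rid K A).toLinearMap ∘ₗ f.lTensor A

/-- Contraction of the first tensor factor against a linear form. -/
noncomputable def contractFst (f : A →ₗ[K] K) : A ⊗[K] A →ₗ[K] A :=
  (TensorProduct.lid K A).toLinearMap ∘ₗ f.rTensor A

@[simp] theorem contractSnd_tmul (f : A →ₗ[K] K) (x y : A) :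
    contractSnd f (x ⊗ₜ y) = f y • x := by simp [contractSnd]

@[simp] theorem contractFst_tmul (f : A →ₗ[K] K) (x y : A) :
    contractFst f (x ⊗ₜ y) = f x • y := by simp [contractFst]

variable {r : ℕ} {d : Fin r → ℕ} {ρ : ∀ χ, A →ₐ[K] Matrix (Fin (d χ)) (Fin (d χ)) K}

/-- The linear form `x ↦ ∑ tr (c_χ ρ_χ(x))`. -/
noncomputable def weightedCharacter (ρ : ∀ χ, A →ₐ[K] Matrix (Fin (d χ)) (Fin (d χ)) K)
    (c : ∀ χ, Matrix (Fin (d χ)) (Fin (d χ)) K) : A →ₗ[K] K :=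
  ∑ χ, Matrix.traceLinearMap _ K K ∘ₗ LinearMap.mulLeft K (c χ) ∘ₗ (ρ χ).toLinearMap

theorem weightedCharacter_apply (c : ∀ χ, Matrix (Fin (d χ)) (Fin (d χ)) K) (x : A) :
    weightedCharacter ρ c x = ∑ χ, (c χ * ρ χ x).trace := by
  simp [weightedCharacter]

theorem rep_contractSnd (c : ∀ χ, Matrix (Fin (d χ)) (Fin (d χ)) K) (x : A) (t : A ⊗[K] A)
    (ψ : Fin r) (i j : Fin (d ψ)) :
    ρ ψ (contractSnd (weightedCharacter ρ c ∘ₗ LinearMap.mulRight K x) t) i j =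
      ∑ χ, ∑ k, ∑ l, kroneckerRep (ρ ψ) (ρ χ) t (i, k) (j, l) * (ρ χ x * c χ) l k := by
  induction t using TensorProduct.induction_on with
  | zero => simp
  | tmul a b =>
    simp only [contractSnd_tmul, LinearMap.comp_apply, LinearMap.mulRight_apply,
      weightedCharacter_apply, map_mul, map_smul, Matrix.smul_apply, smul_eq_mul, Finset.sum_mul,
      kroneckerRep_tmul, Matrix.kronecker_apply]
    refine Finset.sum_congr rfl fun χ _ => ?_
    rw [Matrix.trace_mul_comm, mul_assoc, Matrix.trace, Finset.sum_mul]
    refine Finset.sum_congr rfl fun k _ => ?_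
    rw [Matrix.diag_apply, Matrix.mul_apply, Finset.sum_mul]
    exact Finset.sum_congr rfl fun l _ => by ring
  | add a b ha hb => simp [ha, hb, Finset.sum_add_distrib, add_mul]

theorem rep_contractFst (c : ∀ χ, Matrix (Fin (d χ)) (Fin (d χ)) K) (x : A) (t : A ⊗[K] A)
    (ψ : Fin r) (k l : Fin (d ψ)) :
    ρ ψ (contractFst (weightedCharacter ρ c ∘ₗ LinearMap.mulLeft K x) t) k l =
      ∑ χ, ∑ i, ∑ j, kroneckerRep (ρ χ) (ρ ψ) t (i, k) (j, l) * (c χ * ρ χ x) j i := by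
  induction t using TensorProduct.induction_on with
  | zero => simp
  | tmul a b =>
    simp only [contractFst_tmul, LinearMap.comp_apply, LinearMap.mulLeft_apply,
      weightedCharacter_apply, map_mul, map_smul, Matrix.smul_apply, smul_eq_mul, Finset.sum_mul,
      kroneckerRep_tmul, Matrix.kronecker_apply]
    refine Finset.sum_congr rfl fun χ _ => ?_
    rw [← mul_assoc, Matrix.trace_mul_comm, Matrix.trace, Finset.sum_mul]
    refine Finset.sum_congr rfl fun i _ => ?_
    rw [Matrix.diag_apply, Matrix.mul_apply, Finset.sum_mul]
    exact Finset.sum_congr rfl fun j _ => by ring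
  | add a b ha hb => simp [ha, hb, Finset.sum_add_distrib, add_mul]

/-- A Casimir tensor `ν` with `m(ν) = N ≠ 0` in a split semisimple algebra is dual to a
nondegenerate linear form, with Nakayama automorphism `s`. -/
theorem exists_frobeniusForm [IsAlgClosed K] [FiniteDimensional K A] [IsSemisimpleRing A]
    {ν : A ⊗[K] A} {s : A → A} {N : K} (hN : N ≠ 0)
    (h1 : ∀ h, (h ⊗ₜ 1) * ν = ν * (1 ⊗ₜ h)) (h2 : ∀ h, ν * (h ⊗ₜ 1) = (1 ⊗ₜ s h) * ν)
    (h3 : LinearMap.mul' K A ν = algebraMap K A N) :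
    ∃ (r : ℕ) (d : Fin r → ℕ) (ρ : ∀ χ, A →ₐ[K] Matrix (Fin (d χ)) (Fin (d χ)) K)
      (c c' : ∀ χ, Matrix (Fin (d χ)) (Fin (d χ)) K),
      (∀ χ, Function.Surjective (ρ χ)) ∧
      (∀ x y, (∀ χ, ρ χ x = ρ χ y) → x = y) ∧
      (∀ χ, c χ * c' χ = 1) ∧ (∀ χ h, c χ * ρ χ h = ρ χ (s h) * c χ) ∧
      (∀ χ, (c χ).trace = N) ∧
      (∀ x, contractSnd (weightedCharacter ρ c' ∘ₗ LinearMap.mulRight K x) ν = x) ∧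
      (∀ x, contractFst (weightedCharacter ρ c' ∘ₗ LinearMap.mulLeft K x) ν = x) ∧
      (∀ x y, weightedCharacter ρ c' (x * y) = weightedCharacter ρ c' (s y * x)) := by
  classical
  obtain ⟨r, d, hd, ⟨e⟩⟩ := IsSemisimpleRing.exists_algEquiv_pi_matrix_of_isAlgClosed K A
  let ρ : ∀ χ, A →ₐ[K] Matrix (Fin (d χ)) (Fin (d χ)) K := fun χ =>
    (Pi.evalAlgHom K _ χ).comp e.toAlgHom
  have hρe (x : A) (χ : Fin r) : ρ χ x = e x χ := rfl
  have hsurj : ∀ χ, Function.Surjective (ρ χ) := fun χ M =>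
    ⟨e.symm (Pi.single χ M), by simp [hρe]⟩
  have hinj : ∀ x y, (∀ χ, ρ χ x = ρ χ y) → x = y := fun x y h =>
    e.injective (funext h)
  choose c hc using fun χ => exists_kroneckerRep_eq h1 (hsurj χ)
  have hcross : ∀ χ ψ, χ ≠ ψ → kroneckerRep (ρ χ) (ρ ψ) ν = 0 := fun χ ψ h =>
    -- The central idempotent of the block `χ` separates it from `ψ`.
    kroneckerRep_eq_zero_of_separated (e := e.symm (Pi.single χ 1)) h1 (by simp [hρe])
      (by simp [hρe, h.symm])
  have hint : ∀ χ h, c χ * ρ χ h = ρ χ (s h) * c χ := fun χ h =>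
    intertwine_of_kroneckerRep_eq h2 (hc χ) h
  have htr : ∀ χ, (c χ).trace = N := fun χ =>
    have := hd χ
    trace_of_kroneckerRep_eq h3 (hc χ)
  have hunit : ∀ χ, IsUnit (c χ) := fun χ =>
    isUnit_of_intertwine (hsurj χ) (hint χ) fun h => hN (by rw [← htr χ, h, Matrix.trace_zero])
  have hmul : ∀ χ, c χ * (c χ)⁻¹ = 1 := fun χ =>
    Matrix.mul_nonsing_inv _ ((Matrix.isUnit_iff_isUnit_det _).mp (hunit χ))
  have hmul' : ∀ χ, (c χ)⁻¹ * c χ = 1 := fun χ =>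
    Matrix.nonsing_inv_mul _ ((Matrix.isUnit_iff_isUnit_det _).mp (hunit χ))
  refine ⟨r, d, ρ, c, fun χ => (c χ)⁻¹, hsurj, hinj, hmul, hint, htr, fun x => ?_, fun x => ?_,
    fun x y => ?_⟩
  · refine hinj _ _ fun ψ => ?_
    ext i j
    rw [rep_contractSnd, Finset.sum_eq_single ψ]
    · simp only [hc, ite_mul, zero_mul, Finset.sum_ite_eq, Finset.mem_univ, if_true]
      have := congr($(mul_assoc (ρ ψ x) (c ψ)⁻¹ (c ψ)) i j)
      rw [hmul', mul_one, Matrix.mul_apply] at this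
      rw [← this]
      exact Finset.sum_congr rfl fun k _ => mul_comm _ _
    · intro χ _ h
      simp [hcross ψ χ h.symm]
    · simp
  · refine hinj _ _ fun ψ => ?_
    ext k l
    rw [rep_contractFst, Finset.sum_eq_single ψ]
    · rw [Finset.sum_comm]
      simp only [hc, ite_mul, zero_mul, Finset.sum_ite_eq', Finset.mem_univ, if_true]
      have := congr($(mul_assoc (c ψ) (c ψ)⁻¹ (ρ ψ x)) k l)
      rw [hmul, one_mul] at this
      rw [this, Matrix.mul_apply]
    · intro χ _ h
      simp [hcross χ ψ h]
    · simp
  · rw [weightedCharacter_apply, weightedCharacter_apply]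
    refine Finset.sum_congr rfl fun χ _ => ?_
    have : (c χ)⁻¹ * ρ χ (s y) = ρ χ y * (c χ)⁻¹ := by
      calc _ = (c χ)⁻¹ * (ρ χ (s y) * c χ) * (c χ)⁻¹ := by simp only [mul_assoc, hmul, mul_one]
        _ = _ := by rw [← hint, ← mul_assoc, hmul', one_mul]
    rw [map_mul, map_mul, ← mul_assoc, ← mul_assoc, this, mul_assoc (ρ χ y),
      Matrix.trace_mul_comm]

end FrobeniusForm

/-! ### Contraction calculus and the trace in dual bases -/

section Contractions

open scoped TensorProduct

variable {K : Type u} {A : Type v} [Field K] [Ring A] [Algebra K A]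

theorem contractSnd_lTensor (f : A →ₗ[K] K) (φ : A →ₗ[K] A) (t : A ⊗[K] A) :
    contractSnd f (φ.lTensor A t) = contractSnd (f ∘ₗ φ) t := by
  induction t using TensorProduct.induction_on with
  | zero => simp
  | tmul x y => simp
  | add a b ha hb => simp [ha, hb]

theorem contractFst_lTensor (f : A →ₗ[K] K) (φ : A →ₗ[K] A) (t : A ⊗[K] A) :
    contractFst f (φ.lTensor A t) = φ (contractFst f t) := by
  induction t using TensorProduct.induction_on with
  | zero => simp
  | tmul x y => simp
  | add a b ha hb => simp [ha, hb]

theorem contractFst_rTensor (f : A →ₗ[K] K) (φ : A →ₗ[K] A) (t : A ⊗[K] A) :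
    contractFst f (φ.rTensor A t) = contractFst (f ∘ₗ φ) t := by
  induction t using TensorProduct.induction_on with
  | zero => simp
  | tmul x y => simp
  | add a b ha hb => simp [ha, hb]

theorem contractFst_map (f : A →ₗ[K] K) (φ ψ : A →ₗ[K] A) (t : A ⊗[K] A) :
    contractFst f (TensorProduct.map φ ψ t) = ψ (contractFst (f ∘ₗ φ) t) := by
  induction t using TensorProduct.induction_on with
  | zero => simp
  | tmul x y => simp
  | add a b ha hb => simp [ha, hb]

theorem apply_contractSnd (f g : A →ₗ[K] K) (t : A ⊗[K] A) :
    g (contractSnd f t) = f (contractFst g t) := by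
  induction t using TensorProduct.induction_on with
  | zero => simp
  | tmul x y => simp [mul_comm]
  | add a b ha hb => simp [ha, hb]

theorem contractSnd_mul_tmul_one (f : A →ₗ[K] K) (t : A ⊗[K] A) (w : A) :
    contractSnd f (t * (w ⊗ₜ 1)) = contractSnd f t * w := by
  induction t using TensorProduct.induction_on with
  | zero => simp
  | tmul x y => simp
  | add a b ha hb => simp [ha, hb, add_mul]

theorem contractSnd_tmul_one_mul (f : A →ₗ[K] K) (t : A ⊗[K] A) (w : A) :
    contractSnd f ((w ⊗ₜ 1) * t) = w * contractSnd f t := by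
  induction t using TensorProduct.induction_on with
  | zero => simp
  | tmul x y => simp
  | add a b ha hb => simp [ha, hb, mul_add]

theorem contractSnd_mul_one_tmul (f : A →ₗ[K] K) (t : A ⊗[K] A) (w : A) :
    contractSnd f (t * (1 ⊗ₜ w)) = contractSnd (f ∘ₗ LinearMap.mulRight K w) t := by
  induction t using TensorProduct.induction_on with
  | zero => simp
  | tmul x y => simp
  | add a b ha hb => simp only [map_add, ha, hb, add_mul]

theorem contractSnd_one_tmul_mul (f : A →ₗ[K] K) (t : A ⊗[K] A) (w : A) :
    contractSnd f ((1 ⊗ₜ w) * t) = contractSnd (f ∘ₗ LinearMap.mulLeft K w) t := by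
  induction t using TensorProduct.induction_on with
  | zero => simp
  | tmul x y => simp
  | add a b ha hb => simp only [map_add, ha, hb, mul_add]

/-- The trace of an endomorphism, computed in a pair of dual bases for a Frobenius form. -/
theorem trace_eq_of_frobeniusForm [FiniteDimensional K A] {ν : A ⊗[K] A} {lam : A →ₗ[K] K}
    (hD : ∀ x, contractSnd (lam ∘ₗ LinearMap.mulRight K x) ν = x) (f : A →ₗ[K] A) :
    LinearMap.trace K A f =
      lam (LinearMap.mul' K A (TensorProduct.comm K A A (f.rTensor A ν))) := by
  obtain ⟨s, rfl⟩ := TensorProduct.exists_finset ν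
  -- Writing `ν = ∑ aᵢ ⊗ bᵢ`, duality reads `x = ∑ λ(bᵢ x) aᵢ`, which presents `f` as a sum of rank
  -- one maps.
  have : f = ∑ i ∈ s, (lam ∘ₗ LinearMap.mulLeft K i.2).smulRight (f i.1) := by
    ext x
    conv_lhs => rw [← hD x]
    simp [map_sum]
  conv_lhs => rw [this]
  simp [map_sum]

end Contractions

/-! ### Radford's formula and traces involving the squared antipode -/

section HopfTrace

open scoped TensorProduct
open Coalgebra HopfAlgebra

variable {K : Type u} {H : Type v} [Field K] [Ring H] [HopfAlgebra K H]

theorem comul_contractSnd_comul (f : H →ₗ[K] K) (x : H) :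
    comul (R := K) (contractSnd f (comul (R := K) x)) =
        (contractSnd f ∘ₗ comul).lTensor H (comul (R := K) x) := by
  have h1 (y : H) (t : H ⊗[K] H) :
      (contractSnd f).lTensor H (TensorProduct.assoc K H H H (t ⊗ₜ y)) = f y • t := by
    induction t using TensorProduct.induction_on with
    | zero => simp
    | tmul a b => simp
    | add a b ha hb => simp only [TensorProduct.add_tmul, map_add, ha, hb, smul_add]
  rw [LinearMap.lTensor_comp_apply, ← coassoc_apply]
  generalize comul (R := K) x = t
  induction t using TensorProduct.induction_on with
  | zero => simp
  | tmul a b => simp [h1]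
  | add a b ha hb => simp only [map_add, ha, hb]

theorem comul_contractFst_comul (f : H →ₗ[K] K) (x : H) :
    comul (R := K) (contractFst f (comul (R := K) x)) =
        (contractFst f ∘ₗ comul).rTensor H (comul (R := K) x) := by
  have h1 (y : H) (t : H ⊗[K] H) :
      (contractFst f).rTensor H ((TensorProduct.assoc K H H H).symm (y ⊗ₜ t)) = f y • t := by
    induction t using TensorProduct.induction_on with
    | zero => simp
    | tmul a b => simp [TensorProduct.smul_tmul']
    | add a b ha hb => simp only [TensorProduct.tmul_add, map_add, ha, hb, smul_add]
  rw [LinearMap.rTensor_comp_apply, ← coassoc_symm_apply]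
  generalize comul (R := K) x = t
  induction t using TensorProduct.induction_on with
  | zero => simp
  | tmul a b => simp [h1]
  | add a b ha hb => simp only [map_add, ha, hb]

theorem contractFst_counit_comul (x : H) : contractFst (counit (R := K)) (comul (R := K) x) =
    x := by
  simp [contractFst]

theorem contractSnd_counit_comul (x : H) : contractSnd (counit (R := K)) (comul (R := K) x) =
    x := by
  simp [contractSnd]

/-- A linear form `λ` on `H` dual to the integral `Λ`, in the sense that `λ` is a Frobenius form
with dual tensor `Λ₁ ⊗ S(Λ₂)`. -/
structure IsDualForm (Λ : H) (lam : H →ₗ[K] K) : Prop where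
  snd : ∀ x, contractSnd (lam ∘ₗ LinearMap.mulRight K x) (hopfNu K H Λ) = x
  fst : ∀ x, contractFst (lam ∘ₗ LinearMap.mulLeft K x) (hopfNu K H Λ) = x
  nakayama : ∀ x y, lam (x * y) = lam (antipode K (antipode K y) * x)

variable {Λ : H} {lam : H →ₗ[K] K}

theorem IsDualForm.contractFst_integral (h : IsDualForm Λ lam)
    (hS : Function.Injective (antipode K (A := H))) :
    contractFst lam (comul (R := K) Λ) = 1 := by
  have := h.fst 1
  rw [hopfNu, contractFst_lTensor] at this
  apply hS
  rw [antipode_one, ← this]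
  congr 3
  ext; simp

theorem IsDualForm.exists_eq (h : IsDualForm Λ lam) (x : H) :
    ∃ f, x = contractSnd f (comul (R := K) Λ) :=
  ⟨_, by rw [← contractSnd_lTensor]; exact (h.snd x).symm⟩

/-- This says that `λ` is an integral of the dual Hopf algebra. Every `x` has the form `Λ₁ f(Λ₂)`,
so coassociativity reduces the claim to `λ(Λ₁) Λ₂ = 1`. -/
theorem IsDualForm.contractFst_comul (h : IsDualForm Λ lam)
    (hS : Function.Injective (antipode K (A := H))) (x : H) :
    contractFst lam (comul (R := K) x) = lam x • 1 := by
  obtain ⟨f, rfl⟩ := h.exists_eq x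
  rw [comul_contractSnd_comul, contractFst_lTensor, h.contractFst_integral hS, apply_contractSnd,
    h.contractFst_integral hS]
  simp [contractSnd, Algebra.TensorProduct.one_def]

theorem IsDualForm.contractSnd_comul (h : IsDualForm Λ lam)
    (hS : Function.Injective (antipode K (A := H))) (x : H) :
    contractSnd lam (comul (R := K) x) = lam x • contractSnd lam (comul (R := K) Λ) := by
  obtain ⟨f, rfl⟩ := h.exists_eq x
  rw [comul_contractSnd_comul, contractSnd_lTensor, apply_contractSnd,
    h.contractFst_integral hS]
  have : lam ∘ₗ (contractSnd f ∘ₗ comul) = f 1 • lam := by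
    ext y
    simp [apply_contractSnd, h.contractFst_comul hS, mul_comm]
  rw [this]
  simp [contractSnd, LinearMap.lTensor_smul]

/-- The distinguished group-like element. -/
theorem IsDualForm.isGroupLikeElem (h : IsDualForm Λ lam)
    (hS : Function.Injective (antipode K (A := H))) :
    IsGroupLikeElem K (contractSnd lam (comul (R := K) Λ)) where
  counit_eq_one := by
    have := congr(counit (R := K) $(h.contractFst_integral hS))
    rw [← apply_contractSnd, contractSnd_counit_comul] at this
    rw [apply_contractSnd, contractFst_counit_comul, this, Bialgebra.counit_one]
  comul_eq_tmul_self := by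
    rw [comul_contractSnd_comul]
    have : (contractSnd lam ∘ₗ comul) = lam.smulRight (contractSnd lam (comul (R := K) Λ)) := by
      ext x; simp [h.contractSnd_comul hS x]
    rw [this]
    have key (a : H) (t : H ⊗[K] H) :
        (lam.smulRight a).lTensor H t = contractSnd lam t ⊗ₜ a := by
      induction t using TensorProduct.induction_on with
      | zero => simp
      | tmul x y => simp [TensorProduct.smul_tmul]
      | add x y hx hy => simp only [map_add, hx, hy, TensorProduct.add_tmul]
    exact key _ _

/-- Radford's formula for the fourth power of the antipode (unimodular case). -/
theorem IsDualForm.antipode_pow_four (h : IsDualForm Λ lam)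
    (hL : ∀ h : H, h * Λ = counit (R := K) h • Λ) (hR : ∀ h : H, Λ * h = counit (R := K) h • Λ)
    (w : H) : antipode K (antipode K (antipode K (antipode K w))) * contractSnd lam (comul (R :=
        K) Λ) = contractSnd lam (comul (R := K) Λ) * w := by
  rw [← contractSnd_mul_tmul_one, comul_integral_mul_tmul_one hR, contractSnd_mul_one_tmul,
    ← contractSnd_tmul_one_mul, ← one_tmul_mul_comul_integral hL, contractSnd_one_tmul_mul]
  congr 2
  ext y
  simp [h.nakayama y]

theorem finite_groupLike [FiniteDimensional K H] : Finite (GroupLike K H) :=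
  (linearIndep_groupLikeVal (R := K) (A := H)).finite

theorem IsDualForm.exists_pow_eq_one [FiniteDimensional K H] (h : IsDualForm Λ lam)
    (hS : Function.Injective (antipode K (A := H)))
    (hL : ∀ h : H, h * Λ = counit (R := K) h • Λ) (hR : ∀ h : H, Λ * h = counit (R := K) h • Λ) :
    ∃ k, 0 < k ∧ (antipode K ∘ₗ antipode K (A := H) : Module.End K H) ^ k = 1 := by
  set a := contractSnd lam (comul (R := K) Λ) with ha
  have := finite_groupLike (K := K) (H := H)
  obtain ⟨k, hk, hk1⟩ := (isOfFinOrder_of_finite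
    (⟨a, h.isGroupLikeElem hS⟩ : GroupLike K H)).exists_pow_eq_one
  have hk2 : a ^ k = 1 := by simpa using congr(GroupLike.val $hk1)
  -- Conjugation by `a` is `S⁴`, so `a ^ k = 1` kills the `2k`-th power of `S²`.
  refine ⟨2 * k, by omega, ?_⟩
  rw [pow_mul]
  ext w
  have key (j : ℕ) (w : H) : (((antipode K ∘ₗ antipode K (A :=
      H) : Module.End K H) ^ 2) ^ j) w * a ^ j = a ^ j * w := by
    induction j generalizing w with
    | zero => simp
    | succ j ih =>
      rw [pow_succ' _ j, pow_succ' a, Module.End.mul_apply, ← mul_assoc]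
      have h4 (y : H) : ((antipode K ∘ₗ antipode K (A := H) : Module.End K H) ^ 2) y =
          antipode K (antipode K (antipode K (antipode K y))) := by simp [pow_two]
      rw [h4, h.antipode_pow_four hL hR, mul_assoc, ih, mul_assoc]
  simpa [hk2] using key k w

/-- In the dual bases given by `ν` the trace becomes `λ(S(S(y₁) y₂))` with `y = f(Λ₁) Λ₂`, and the
antipode axiom collapses it. It is used for `f = ε` and for `f` the regular character. -/
theorem IsDualForm.trace_antipode_sq_comp [FiniteDimensional K H] (h : IsDualForm Λ lam)
    (f : H →ₗ[K] K) :
    LinearMap.trace K H ((antipode K ∘ₗ antipode K (A := H)) ∘ₗ (contractFst f ∘ₗ comul)) =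
        f Λ * lam 1 := by
  rw [trace_eq_of_frobeniusForm h.snd, hopfNu]
  have h1 (t : H ⊗[K] H) : LinearMap.mul' K H (TensorProduct.comm K H H
      ((antipode K ∘ₗ antipode K (A := H)).rTensor H ((antipode K (A := H)).lTensor H t))) =
          antipode K (LinearMap.mul' K H ((antipode K (A := H)).rTensor H t)) := by
    induction t using TensorProduct.induction_on with
    | zero => simp
    | tmul x y => simp [antipode_mul_eq]
    | add a b ha hb => simp only [map_add, ha, hb]
  have h2 (φ : H →ₗ[K] H) (t : H ⊗[K] H) :
      φ.rTensor H ((antipode K (A := H)).lTensor H t) =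
      (antipode K (A := H)).lTensor H (φ.rTensor H t) := by
    rw [← LinearMap.comp_apply, ← LinearMap.comp_apply, LinearMap.rTensor_comp_lTensor,
      LinearMap.lTensor_comp_rTensor]
  rw [LinearMap.rTensor_comp_apply, h2, h1, ← comul_contractFst_comul,
    mul_antipode_rTensor_comul_apply, ← apply_contractSnd, contractSnd_counit_comul]
  simp [Algebra.algebraMap_eq_smul_one]

/-- The character of the regular representation. -/
noncomputable def regularCharacter (K : Type u) (A : Type v) [Field K] [Ring A] [Algebra K A] :
    A →ₗ[K] K :=
  LinearMap.trace K A ∘ₗ LinearMap.mul K A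

theorem regularCharacter_apply (x : H) :
    regularCharacter K H x = LinearMap.trace K H (LinearMap.mulLeft K x) := rfl

theorem regularCharacter_integral [FiniteDimensional K H]
    (hR : ∀ h : H, Λ * h = counit (R := K) h • Λ) :
    regularCharacter K H Λ = counit (R := K) Λ := by
  have : LinearMap.mulLeft K Λ = (counit (R := K)).smulRight Λ := by ext x; simp [hR]
  rw [regularCharacter_apply, this]
  simp

/-- The left side is the trace of `Δ(y)` on `H ⊗ H`. The map `x ⊗ z ↦ Δ(x)(1 ⊗ z)` identifies that
module with `n` copies of the regular one. -/
theorem regularCharacter_contractFst_comul [FiniteDimensional K H] (y : H) :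
    regularCharacter K H (contractFst (regularCharacter K H) (comul (R := K) y)) =
      (Module.finrank K H : K) * regularCharacter K H y := by
  have h1 (t : H ⊗[K] H) : regularCharacter K H (contractFst (regularCharacter K H) t) =
      LinearMap.trace K (H ⊗[K] H) (LinearMap.mulLeft K t) := by
    induction t using TensorProduct.induction_on with
    | zero => simp
    | tmul a b =>
      have : LinearMap.mulLeft K (a ⊗ₜ[K] b) =
          TensorProduct.map (LinearMap.mulLeft K a) (LinearMap.mulLeft K b) := by
        ext; simp
      rw [this, LinearMap.trace_tensorProduct']
      simp [regularCharacter_apply]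
    | add a b ha hb =>
      have : LinearMap.mulLeft K (a + b) = LinearMap.mulLeft K a + LinearMap.mulLeft K b := by
        ext; simp [add_mul]
      simp only [map_add, ha, hb, this]
  let φ : Module.End K (H ⊗[K] H) := TensorProduct.lift
    (LinearMap.mk₂ K (fun x z => comul (R := K) x * ((1 : H) ⊗ₜ[K] z))
      (by intros; simp [add_mul]) (by intros; simp)
      (by intros; simp [TensorProduct.tmul_add, mul_add]) (by intros; simp))
  let ψ : Module.End K (H ⊗[K] H) := TensorProduct.lift
    (LinearMap.mk₂ K (fun x z => (antipode K (A := H)).lTensor H (comul (R :=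
        K) x) * ((1 : H) ⊗ₜ[K] z))
      (by intros; simp [add_mul]) (by intros; simp)
      (by intros; simp [TensorProduct.tmul_add, mul_add]) (by intros; simp))
  have hφψ : φ * ψ = 1 := by
    ext x z
    have h2 : ψ (x ⊗ₜ z) = ∑ i ∈ (ℛ K x).index,
        (ℛ K x).left i ⊗ₜ (antipode K ((ℛ K x).right i) * z) := by
      simp only [ψ, TensorProduct.lift.tmul, LinearMap.mk₂_apply]
      conv_lhs => rw [← (ℛ K x).eq]
      simp [Finset.sum_mul]
    have h3 : (x ⊗ₜ[K] z : H ⊗[K] H) = (x ⊗ₜ 1) * (1 ⊗ₜ z) := by simp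
    change φ (ψ (x ⊗ₜ z)) = x ⊗ₜ z
    rw [h2, h3, ← sum_comul_mul_one_tmul_antipode (ℛ K x), Finset.sum_mul]
    simp [φ, mul_assoc]
  -- In finite dimension a one-sided inverse is two-sided.
  have hψφ : ψ * φ = 1 := mul_eq_one_comm.mp hφψ
  have hc : LinearMap.mulLeft K (comul (R := K) y) * φ =
      φ * TensorProduct.map (LinearMap.mulLeft K y) LinearMap.id := by
    ext x z
    simp [φ, mul_assoc]
  rw [h1]
  calc LinearMap.trace K _ (LinearMap.mulLeft K (comul (R := K) y))
      = LinearMap.trace K _ (LinearMap.mulLeft K (comul (R := K) y) * φ * ψ) := by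
        rw [mul_assoc, hφψ, mul_one]
    _ = LinearMap.trace K _ (ψ * (φ * TensorProduct.map (LinearMap.mulLeft K y) LinearMap.id)) := by
        rw [hc, LinearMap.trace_mul_comm]
    _ = _ := by
        rw [← mul_assoc, hψφ, one_mul, LinearMap.trace_tensorProduct', LinearMap.trace_id,
          mul_comm, regularCharacter_apply]

/-- `S²` is an algebra automorphism, so it conjugates multiplication by `x` into multiplication by
`S² x`. -/
theorem regularCharacter_antipode_antipode [FiniteDimensional K H]
    (hS : Function.Injective (antipode K (A := H)))
    (x : H) : regularCharacter K H (antipode K (antipode K x)) = regularCharacter K H x := by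
  let e : H ≃ₗ[K] H := LinearEquiv.ofInjectiveEndo (antipode K ∘ₗ antipode K (A := H)) (hS.comp hS)
  rw [regularCharacter_apply, regularCharacter_apply,
      ← LinearMap.trace_conj' (LinearMap.mulLeft K x) e]
  congr 1
  ext y
  obtain ⟨z, rfl⟩ := e.surjective y
  rw [LinearEquiv.conj_apply_apply, LinearEquiv.symm_apply_apply]
  simp [e, antipode_mul_eq]

/-- Convolution with the regular character, normalized to an idempotent. -/
noncomputable def regularProjection (K : Type u) (H : Type v) [Field K] [Ring H]
    [HopfAlgebra K H] : Module.End K H :=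
  (Module.finrank K H : K)⁻¹ • (contractFst (regularCharacter K H) ∘ₗ comul)

theorem isIdempotentElem_regularProjection [FiniteDimensional K H]
    (hn : (Module.finrank K H : K) ≠ 0) : IsIdempotentElem (regularProjection K H) := by
  ext x
  have : (regularCharacter K H) ∘ₗ (contractFst (regularCharacter K H) ∘ₗ comul) =
      (Module.finrank K H : K) • regularCharacter K H := by
    ext y; simp [regularCharacter_contractFst_comul]
  simp only [regularProjection, Module.End.mul_apply, LinearMap.smul_apply, LinearMap.comp_apply,
    map_smul, comul_contractFst_comul, contractFst_rTensor, this]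
  simp [contractFst, LinearMap.rTensor_smul, hn]

theorem commute_antipode_sq_regularProjection [FiniteDimensional K H]
    (hS : Function.Injective (antipode K (A := H))) :
    Commute (antipode K ∘ₗ antipode K (A := H) : Module.End K H) (regularProjection K H) := by
  have : (regularCharacter K H) ∘ₗ (antipode K ∘ₗ antipode K (A := H)) = regularCharacter K H := by
    ext y; simp [regularCharacter_antipode_antipode hS]
  ext x
  simp [regularProjection, comul_antipode_antipode, contractFst_map, this]

theorem IsDualForm.trace_antipode_sq [FiniteDimensional K H] (h : IsDualForm Λ lam) :
    LinearMap.trace K H (antipode K ∘ₗ antipode K (A := H)) = counit (R := K) Λ * lam 1 := by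
  rw [← h.trace_antipode_sq_comp]
  congr 1
  ext x
  simp [contractFst_counit_comul]

theorem IsDualForm.trace_antipode_sq_regularProjection [FiniteDimensional K H]
    (h : IsDualForm Λ lam) (hR : ∀ h : H, Λ * h = counit (R := K) h • Λ)
    (hn : (Module.finrank K H : K) ≠ 0)
    (hΛ : counit (R := K) Λ = (Module.finrank K H : K)) :
    LinearMap.trace K H ((antipode K ∘ₗ antipode K (A :=
        H) : Module.End K H) * regularProjection K H) = lam 1 := by
  rw [regularProjection, mul_smul_comm, map_smul, Module.End.mul_eq_comp,
    h.trace_antipode_sq_comp, regularCharacter_integral hR, hΛ, smul_eq_mul,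
    inv_mul_cancel_left₀ hn]

end HopfTrace

/-! ### Spectral projections of operators of finite order -/

section SpectralProjections

variable {K : Type u} [Field K] {B : Type v} [Ring B] [Algebra K B]

/-- The spectral projections of an element of finite order. -/
theorem exists_spectralProjections [CharZero K] {ζ : K} {k : ℕ} (hk : 0 < k)
    (hζ : IsPrimitiveRoot ζ k) {a : B} (ha : a ^ k = 1) :
    ∃ P : ℕ → B, (∀ j, IsIdempotentElem (P j)) ∧ (∀ j b, Commute a b → Commute (P j) b) ∧
      ∑ j ∈ Finset.range k, P j = 1 ∧ ∀ j s, a ^ s * P j = (ζ ^ j) ^ s • P j := by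
  have hζ0 : ζ ≠ 0 := hζ.ne_zero hk.ne'
  have hk0 : (k : K) ≠ 0 := by exact_mod_cast hk.ne'
  -- Discrete Fourier averages over the cyclic group generated by `a`.
  let P : ℕ → B := fun j => (k : K)⁻¹ • ∑ s ∈ Finset.range k, ((ζ ^ j)⁻¹) ^ s • a ^ s
  have hP1 (j : ℕ) : a * P j = ζ ^ j • P j := by
    have hz : ζ ^ j ≠ 0 := pow_ne_zero _ hζ0
    let f : ℕ → B := fun s => ((ζ ^ j)⁻¹) ^ s • a ^ s
    have hf : f k = f 0 := by
      have : (ζ ^ j) ^ k = 1 := by rw [← pow_mul, mul_comm, pow_mul, hζ.pow_eq_one, one_pow]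
      simp [f, ha, this]
    have hs : ∑ s ∈ Finset.range k, f (s + 1) = ∑ s ∈ Finset.range k, f s := by
      have h1 := Finset.sum_range_succ f k
      have h2 := Finset.sum_range_succ' f k
      rw [h1, hf] at h2
      exact (add_right_cancel h2).symm
    calc a * P j = (k : K)⁻¹ • ∑ s ∈ Finset.range k, ζ ^ j • f (s + 1) := by
          simp only [P, f, mul_smul_comm, Finset.mul_sum, smul_smul]
          congr 1
          refine Finset.sum_congr rfl fun s _ => ?_
          rw [pow_succ' (ζ ^ j)⁻¹, ← mul_assoc, mul_inv_cancel₀ hz, one_mul, pow_succ' a]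
      _ = ζ ^ j • P j := by rw [← Finset.smul_sum, hs, smul_comm]
  have hP (j s : ℕ) : a ^ s * P j = (ζ ^ j) ^ s • P j := by
    induction s with
    | zero => simp
    | succ s ih => rw [pow_succ, mul_assoc, hP1, mul_smul_comm, ih, smul_smul, pow_succ']
  refine ⟨P, fun j => ?_, fun j b hb => ?_, ?_, hP⟩
  · have hz : ζ ^ j ≠ 0 := pow_ne_zero _ hζ0
    change ((k : K)⁻¹ • ∑ s ∈ Finset.range k, ((ζ ^ j)⁻¹) ^ s • a ^ s) * P j = P j
    rw [smul_mul_assoc, Finset.sum_mul]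
    have : ∀ s ∈ Finset.range k, ((ζ ^ j)⁻¹) ^ s • a ^ s * P j = P j := fun s _ => by
      rw [smul_mul_assoc, hP, smul_smul, ← mul_pow, inv_mul_cancel₀ hz, one_pow, one_smul]
    rw [Finset.sum_congr rfl this, Finset.sum_const, Finset.card_range, ← Nat.cast_smul_eq_nsmul K,
      smul_smul, inv_mul_cancel₀ hk0, one_smul]
  · exact (Commute.sum_left _ _ _ fun s _ => (hb.pow_left s).smul_left _).smul_left _
  · simp only [P]
    rw [← Finset.smul_sum, Finset.sum_comm]
    simp only [← Finset.sum_smul]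
    rw [Finset.sum_eq_single 0]
    · rw [inv_smul_eq_iff₀ hk0]
      simp [Algebra.smul_def]
    · intro s hs hs0
      have hs1 : (ζ⁻¹) ^ s ≠ 1 := hζ.inv.pow_ne_one_of_pos_of_lt hs0 (Finset.mem_range.mp hs)
      have hs2 : ((ζ⁻¹) ^ s) ^ k = 1 := by
        rw [← pow_mul, mul_comm, pow_mul, hζ.inv.pow_eq_one, one_pow]
      have : ∑ j ∈ Finset.range k, ((ζ⁻¹) ^ s) ^ j = 0 := by
        rw [geom_sum_eq hs1, hs2, sub_self, zero_div]
      have h3 : ∀ j ∈ Finset.range k, ((ζ ^ j)⁻¹) ^ s = ((ζ⁻¹) ^ s) ^ j := fun j _ => by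
        rw [← inv_pow, ← pow_mul, ← pow_mul, mul_comm]
      rw [Finset.sum_congr rfl h3, this, zero_smul]
    · intro h
      exact absurd (Finset.mem_range.mpr hk) h

variable {V : Type w} [AddCommGroup V] [Module K V] [FiniteDimensional K V]

theorem trace_idempotent_eq_finrank {e : Module.End K V} (he : IsIdempotentElem e) :
    LinearMap.trace K V e = (Module.finrank K (LinearMap.range e) : K) :=
  (LinearMap.IsIdempotentElem.isProj_range e he).trace

/-- The traces of the powers of an endomorphism of finite order are sums of roots of unity. -/
theorem exists_trace_pow_eq [CharZero K] {ζ : K} {k : ℕ} (hk : 0 < k)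
    (hζ : IsPrimitiveRoot ζ k) {T : Module.End K V} (hT : T ^ k = 1) {E : Module.End K V}
    (hE : IsIdempotentElem E) (hTE : Commute T E) :
    ∃ N : ℕ → ℕ, ∀ s, LinearMap.trace K V (T ^ s * E) =
      ∑ j ∈ Finset.range k, (N j : K) * (ζ ^ j) ^ s := by
  obtain ⟨P, hP, hPc, hsum, hPT⟩ := exists_spectralProjections hk hζ hT
  refine ⟨fun j => Module.finrank K (LinearMap.range (P j * E)), fun s => ?_⟩
  have : T ^ s * E = ∑ j ∈ Finset.range k, (ζ ^ j) ^ s • (P j * E) := by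
    calc T ^ s * E = T ^ s * (∑ j ∈ Finset.range k, P j) * E := by rw [hsum, mul_one]
      _ = _ := by simp only [Finset.mul_sum, Finset.sum_mul, hPT, smul_mul_assoc]
  rw [this, map_sum]
  refine Finset.sum_congr rfl fun j _ => ?_
  rw [map_smul, smul_eq_mul, mul_comm,
    trace_idempotent_eq_finrank ((hP j).mul_of_commute (hPc j E hTE) hE)]

end SpectralProjections

/-! ### Averages of roots of unity -/

section RootsOfUnity

/-- If an average of roots of unity is a nonzero algebraic integer, then all the roots of unity
are equal. -/
theorem pow_eq_of_average_integral {F : Type u} [Field F] [NumberField F] {ζ : F} {k : ℕ}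
    (hk : 0 < k) (hζ : ζ ^ k = 1) {N N' : ℕ → ℕ} {ℓ : F}
    (hℓ : ℓ = ∑ j ∈ Finset.range k, (N' j : F) * ζ ^ j) (hℓ0 : ℓ ≠ 0)
    (hN : ((∑ j ∈ Finset.range k, N j : ℕ) : F) * ℓ = ∑ j ∈ Finset.range k, (N j : F) * ζ ^ j)
    {j : ℕ} (hj : j < k) (hNj : N j ≠ 0) : ζ ^ j = ℓ := by
  have hζi : IsIntegral ℤ ζ := IsIntegral.of_pow hk (by rw [hζ]; exact isIntegral_one)
  have hint : IsIntegral ℤ ℓ := by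
    rw [hℓ]
    exact IsIntegral.sum _ fun j _ => (isIntegral_natCast _).mul (hζi.pow _)
  have hnorm (φ : F →+* ℂ) : ‖φ ζ‖ = 1 :=
    Complex.norm_eq_one_of_pow_eq_one (by rw [← map_pow, hζ, map_one]) hk.ne'
  set n := ∑ j ∈ Finset.range k, N j with hn
  have hnpos : 0 < n := lt_of_lt_of_le (Nat.pos_of_ne_zero hNj)
    (Finset.single_le_sum (f := N) (fun _ _ => Nat.zero_le _) (Finset.mem_range.mpr hj))
  have hle (φ : F →+* ℂ) : ‖φ ℓ‖ ≤ 1 := by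
    have h1 := congr(‖φ $hN‖)
    rw [map_mul, map_natCast, norm_mul, Complex.norm_natCast, map_sum] at h1
    have h2 : ‖∑ x ∈ Finset.range k, φ ((N x : F) * ζ ^ x)‖ ≤ n := by
      refine (norm_sum_le _ _).trans ?_
      simp [hnorm, hn]
    have : (0 : ℝ) < n := by exact_mod_cast hnpos
    rw [← h1] at h2
    exact le_of_mul_le_mul_left (by simpa using h2) this
  -- Kronecker's theorem: a nonzero algebraic integer with all conjugates in the closed unit disc is
  -- a root of unity.
  obtain ⟨m, hm, hm1⟩ := NumberField.Embeddings.pow_eq_one_of_norm_le_one F ℂ hℓ0 hint hle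
  obtain ⟨φ⟩ : Nonempty (F →+* ℂ) := inferInstance
  have hℓ1 : ‖φ ℓ‖ = 1 := Complex.norm_eq_one_of_pow_eq_one (by rw [← map_pow, hm1, map_one]) hm.ne'
  let z : ℕ → ℂ := fun j => φ (ζ ^ j * ℓ⁻¹)
  have hz (j : ℕ) : ‖z j‖ = 1 := by simp [z, hnorm, hℓ1]
  -- Equality in the triangle inequality: the terms are nonnegative and sum to zero, so `z j` has
  -- real part 1 wherever `N j ≠ 0`.
  have hsum : ∑ j ∈ Finset.range k, (N j : ℝ) * (1 - (z j).re) = 0 := by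
    have h1 : (n : F) = ∑ j ∈ Finset.range k, (N j : F) * (ζ ^ j * ℓ⁻¹) := by
      simp only [← mul_assoc, ← Finset.sum_mul]
      rw [← hN, mul_assoc, mul_inv_cancel₀ hℓ0, mul_one]
    have h2 := congr((φ $h1).re)
    simp only [map_natCast, map_sum, Complex.re_sum, map_mul φ (Nat.cast _),
      ← Complex.ofReal_natCast, Complex.re_ofReal_mul,
      Complex.ofReal_re] at h2
    simp only [mul_sub, mul_one, Finset.sum_sub_distrib]
    rw [sub_eq_zero, ← Nat.cast_sum, ← hn, h2]
  have hre (j : ℕ) : (z j).re ≤ 1 := (Complex.re_le_norm _).trans_eq (hz j)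
  have hzero := (Finset.sum_eq_zero_iff_of_nonneg fun j _ =>
    mul_nonneg (Nat.cast_nonneg _) (sub_nonneg.mpr (hre j))).mp hsum j (Finset.mem_range.mpr hj)
  have hzj : (z j).re = 1 := by
    rcases mul_eq_zero.mp hzero with h | h
    · exact absurd (by exact_mod_cast h) hNj
    · linarith
  have hz1 : z j = 1 := by
    have h := Complex.re_eq_norm.mp (hzj.trans (hz j).symm)
    apply Complex.ext
    · simpa using hzj
    · simpa using h.2.symm
  have : ζ ^ j * ℓ⁻¹ = 1 := φ.injective (by rw [map_one]; exact hz1)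
  exact (mul_inv_eq_one₀ hℓ0).mp this

/-- Under a complex embedding, inverting a root of unity is conjugation, so each summand is a
squared absolute value. -/
theorem sum_mul_conj_roots_ne_zero {F : Type u} [Field F] (φ : F →+* ℂ) {ζ : F} {k : ℕ}
    (hk : 0 < k) (hζ : ζ ^ k = 1) {ι : Type*} (s : Finset ι) (M : ι → ℕ → ℕ) {i₀ : ι} (hi : i₀ ∈ s)
    (h0 : ∑ j ∈ Finset.range k, (M i₀ j : F) * ζ ^ j ≠ 0) :
    ∑ i ∈ s, (∑ j ∈ Finset.range k, (M i j : F) * ζ ^ j) *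
      (∑ j ∈ Finset.range k, (M i j : F) * (ζ⁻¹) ^ j) ≠ 0 := by
  have hnorm : ‖φ ζ‖ = 1 := Complex.norm_eq_one_of_pow_eq_one (by rw [← map_pow, hζ,
      map_one]) hk.ne'
  have hinv : φ ζ⁻¹ = (starRingEnd ℂ) (φ ζ) := by
    rw [map_inv₀, Complex.inv_eq_conj hnorm]
  have key (i : ι) : φ ((∑ j ∈ Finset.range k, (M i j : F) * ζ ^ j) *
      (∑ j ∈ Finset.range k, (M i j : F) * (ζ⁻¹) ^ j)) =
      ((Complex.normSq (φ (∑ j ∈ Finset.range k, (M i j : F) * ζ ^ j)) : ℝ) : ℂ) := by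
    rw [Complex.normSq_eq_conj_mul_self, mul_comm, map_mul]
    congr 1
    simp only [map_sum, map_mul, map_natCast, map_pow, hinv]
  intro h
  have := congr(φ $h)
  simp only [map_sum φ _ s, key, map_zero] at this
  rw [← Complex.ofReal_sum, Complex.ofReal_eq_zero,
    Finset.sum_eq_zero_iff_of_nonneg fun i _ => Complex.normSq_nonneg _] at this
  have h2 := this i₀ hi
  rw [Complex.normSq_eq_zero, map_eq_zero] at h2
  exact h0 h2

end RootsOfUnity

/-! ### Trace criteria for scalar operators and for nonvanishing -/

section TraceCriterion

variable {K : Type u} [Field K] [IsAlgClosed K] [CharZero K]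

/-- An algebraically closed field of characteristic zero contains the cyclotomic fields. -/
theorem exists_cyclotomic_embedding (k : ℕ) [NeZero k] :
    ∃ ψ : CyclotomicField k ℚ →+* K, ∃ ζ, IsPrimitiveRoot ζ k ∧ IsPrimitiveRoot (ψ ζ) k := by
  let ψ : CyclotomicField k ℚ →ₐ[ℚ] K := IsAlgClosed.lift
  obtain ⟨ζ, hζ⟩ := (CyclotomicField.isCyclotomicExtension k ℚ).exists_isPrimitiveRoot
    (Set.mem_singleton k) (NeZero.ne k)
  exact ⟨ψ.toRingHom, ζ, hζ, hζ.map_of_injective ψ.toRingHom.injective⟩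

/-- An endomorphism of finite order whose trace is `n` times the nonzero trace of its restriction to
a summand is scalar. -/
theorem exists_eq_smul_of_trace {V : Type w} [AddCommGroup V] [Module K V] [FiniteDimensional K V]
    {T E : Module.End K V} {k : ℕ} (hk : 0 < k) (hT : T ^ k = 1) (hE : IsIdempotentElem E)
    (hTE : Commute T E)
    (htr : LinearMap.trace K V T = (Module.finrank K V : K) * LinearMap.trace K V (T * E))
    (h0 : LinearMap.trace K V (T * E) ≠ 0) : ∃ z : K, T = z • 1 := by
  have : NeZero k := ⟨hk.ne'⟩
  obtain ⟨ψ, ζ, hζ, hψζ⟩ := exists_cyclotomic_embedding (K := K) k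
  obtain ⟨N', hN'⟩ := exists_trace_pow_eq hk hψζ hT hE hTE
  obtain ⟨P, hP, hPc, hsum, hPT⟩ := exists_spectralProjections hk hψζ hT
  let N : ℕ → ℕ := fun j => Module.finrank K (LinearMap.range (P j))
  have hTsum : T = ∑ j ∈ Finset.range k, (ψ ζ) ^ j • P j := by
    calc T = T ^ 1 * ∑ j ∈ Finset.range k, P j := by rw [hsum, mul_one, pow_one]
      _ = _ := by
        rw [Finset.mul_sum]
        exact Finset.sum_congr rfl fun j _ => by rw [hPT, pow_one]
  have hNtr : LinearMap.trace K V T = ∑ j ∈ Finset.range k, (N j : K) * (ψ ζ) ^ j := by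
    rw [hTsum, map_sum]
    exact Finset.sum_congr rfl fun j _ => by
      rw [map_smul, trace_idempotent_eq_finrank (hP j), smul_eq_mul, mul_comm]
  have hNsum : ∑ j ∈ Finset.range k, N j = Module.finrank K V := by
    have := congr(LinearMap.trace K V $hsum)
    rw [LinearMap.trace_one, map_sum] at this
    simp only [trace_idempotent_eq_finrank (hP _)] at this
    exact_mod_cast this
  have hE1 := hN' 1
  simp only [pow_one] at hE1
  let ℓ : CyclotomicField k ℚ := ∑ j ∈ Finset.range k, (N' j : CyclotomicField k ℚ) * ζ ^ j
  have hψℓ : ψ ℓ = LinearMap.trace K V (T * E) := by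
    rw [hE1]
    simp [ℓ]
  refine ⟨ψ ℓ, ?_⟩
  have key (j : ℕ) (hj : j ∈ Finset.range k) : (ψ ζ) ^ j • P j = ψ ℓ • P j := by
    by_cases hPj : P j = 0
    · simp [hPj]
    have hNj : N j ≠ 0 := by
      intro h
      apply hPj
      rw [← LinearMap.IsIdempotentElem.trace_eq_zero_iff (R := K) (hP j),
          trace_idempotent_eq_finrank (hP j)]
      exact_mod_cast h
    rw [← map_pow, pow_eq_of_average_integral hk hζ.pow_eq_one (ℓ := ℓ) (N' := N') rfl
      (fun h => h0 (by rw [← hψℓ, h, map_zero])) ?_ (Finset.mem_range.mp hj) hNj]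
    apply ψ.injective
    rw [hNsum, map_mul, map_natCast, hψℓ, ← htr, hNtr]
    simp
  rw [hTsum, Finset.sum_congr rfl key, ← Finset.smul_sum, hsum]

/-- For matrices of finite projective order, `∑ tr(c) tr(c⁻¹)` does not vanish unless all the
traces do. -/
theorem sum_trace_mul_trace_inv_ne_zero {ι : Type*} [Fintype ι] {d : ι → ℕ}
    {c c' : ∀ i, Matrix (Fin (d i)) (Fin (d i)) K} {k : ℕ} (hk : 0 < k)
    (hc : ∀ i, c i * c' i = 1) (hs : ∀ i, ∃ s : K, s ≠ 0 ∧ c i ^ k = s • 1)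
    {i₀ : ι} (h0 : (c i₀).trace ≠ 0) :
    ∑ i, (c i).trace * (c' i).trace ≠ 0 := by
  have : NeZero k := ⟨hk.ne'⟩
  obtain ⟨ψ, ζ, hζ, hψζ⟩ := exists_cyclotomic_embedding (K := K) k
  have h1 (i : ι) : ∃ (z : K) (M : ℕ → ℕ), z ≠ 0 ∧
      (c i).trace = z * ψ (∑ j ∈ Finset.range k, (M j : CyclotomicField k ℚ) * ζ ^ j) ∧
      (c' i).trace = z⁻¹ * ψ (∑ j ∈ Finset.range k, (M j : CyclotomicField k ℚ) * (ζ⁻¹) ^ j) := by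
    obtain ⟨s, hs0, hs⟩ := hs i
    -- Rescaling by a `k`-th root `z` of the scalar makes `b ^ k = 1`; the factors `z` and `z⁻¹`
    -- cancel in the product of traces.
    obtain ⟨z, rfl⟩ := IsAlgClosed.exists_pow_nat_eq s hk
    have hz : z ≠ 0 := fun h => hs0 (by rw [h, zero_pow hk.ne'])
    let b := z⁻¹ • c i
    have hb : b ^ k = 1 := by
      rw [smul_pow, hs, smul_smul, ← mul_pow, inv_mul_cancel₀ hz, one_pow, one_smul]
    have hb' : b ^ (k - 1) = z • c' i := by
      have h2 : b * (z • c' i) = 1 := by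
        simp [b, smul_smul, hc, hz]
      calc b ^ (k - 1) = b ^ (k - 1) * (b * (z • c' i)) := by rw [h2, mul_one]
        _ = b ^ (k - 1 + 1) * (z • c' i) := by rw [← mul_assoc, ← pow_succ]
        _ = z • c' i := by rw [Nat.sub_add_cancel hk, hb, one_mul]
    let T : Module.End K (Fin (d i) → K) := Matrix.toLin' b
    have hT (s : ℕ) : T ^ s = Matrix.toLin' (b ^ s) := (Matrix.toLin'_pow b s).symm
    obtain ⟨M, hM⟩ := exists_trace_pow_eq hk hψζ (T := T) (E := 1)
      (by rw [hT, hb, Matrix.toLin'_one]; rfl) (one_mul 1) (Commute.one_right _)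
    refine ⟨z, M, hz, ?_, ?_⟩
    · have := hM 1
      rw [mul_one, hT, Matrix.trace_toLin'_eq, pow_one, Matrix.trace_smul, smul_eq_mul] at this
      rw [eq_comm, ← eq_inv_mul_iff_mul_eq₀ hz, this]
      simp
    · have := hM (k - 1)
      rw [mul_one, hT, Matrix.trace_toLin'_eq, hb', Matrix.trace_smul, smul_eq_mul] at this
      rw [eq_inv_mul_iff_mul_eq₀ hz, this]
      simp only [map_sum, map_mul, map_natCast, map_pow, map_inv₀]
      refine Finset.sum_congr rfl fun j _ => ?_
      congr 1
      have hp : ((ψ ζ) ^ j) ^ (k - 1) * (ψ ζ) ^ j = 1 := by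
        rw [← pow_succ, Nat.sub_add_cancel hk, ← pow_mul, mul_comm, pow_mul, hψζ.pow_eq_one,
          one_pow]
      rw [inv_pow]
      exact eq_inv_of_mul_eq_one_left hp
  choose z M hz hM hM' using h1
  have h2 (i : ι) : (c i).trace * (c' i).trace =
      ψ ((∑ j ∈ Finset.range k, (M i j : CyclotomicField k ℚ) * ζ ^ j) *
        (∑ j ∈ Finset.range k, (M i j : CyclotomicField k ℚ) * (ζ⁻¹) ^ j)) := by
    rw [hM, hM', map_mul]
    field_simp [hz i]
  simp only [h2]
  rw [← map_sum, map_ne_zero]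
  obtain ⟨φ⟩ : Nonempty (CyclotomicField k ℚ →+* ℂ) := inferInstance
  refine sum_mul_conj_roots_ne_zero φ hk hζ.pow_eq_one _ M (Finset.mem_univ i₀) fun h => h0 ?_
  rw [hM, h, map_zero, mul_zero]

end TraceCriterion

/-! ### Unimodularity and involutivity of the antipode -/

section AntipodeSquared

open scoped TensorProduct
open Coalgebra HopfAlgebra

variable {K : Type u} {H : Type v} [Field K] [Ring H] [HopfAlgebra K H]

/-- A semisimple Hopf algebra is unimodular. -/
theorem IsHopfIntegral.right [IsSemisimpleRing H] {Λ : H} (hL : IsHopfIntegral K H Λ) (h : H) :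
    Λ * h = counit (R := K) h • Λ := by
  rw [← sub_eq_zero]
  set z := Λ * h - counit (R := K) h • Λ with hz
  have h1 (k : H) : z * (k * Λ) = 0 := by
    rw [hL k, mul_smul_comm, hz, sub_mul, mul_assoc, hL h, smul_mul_assoc, mul_smul_comm, sub_self,
      smul_zero]
  -- The left ideal `H z` squares to zero, and a semisimple ring has no nonzero nilpotent left
  -- ideal.
  have h2 (k : H) : z * (k * z) = 0 := by
    rw [hz, mul_sub, ← hz, mul_sub, ← mul_assoc k, ← mul_assoc z, h1, zero_mul, mul_smul_comm,
      mul_smul_comm, h1, smul_zero, sub_zero]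
  obtain ⟨e, he, hspan⟩ := IsSemisimpleRing.ideal_eq_span_idempotent (Ideal.span {z})
  obtain ⟨k, hk⟩ := Ideal.mem_span_singleton'.mp
    (hspan ▸ Ideal.mem_span_singleton_self e : e ∈ Ideal.span {z})
  obtain ⟨l, hl⟩ := Ideal.mem_span_singleton'.mp
    (hspan ▸ Ideal.mem_span_singleton_self z : z ∈ Ideal.span {e})
  have he0 : e = 0 := by
    rw [← he, ← hk, mul_assoc, h2, mul_zero]
  rw [← hl, he0, mul_zero]

/-- A matrix that commutes with all matrices is scalar. -/
theorem Matrix.exists_eq_smul_one_of_commute {m : ℕ} {M : Matrix (Fin m) (Fin m) K}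
    (h : ∀ N, Commute N M) : ∃ z : K, M = z • 1 := by
  obtain ⟨z, hz⟩ := Matrix.mem_range_scalar_iff_commute_single'.mpr fun i j => h (.single i j 1)
  exact ⟨z, by rw [← hz, Matrix.smul_one_eq_diagonal]; rfl⟩

variable [IsAlgClosed K] [CharZero K] [FiniteDimensional K H] [IsSemisimpleRing H]

/-- **Larson–Radford**: the antipode of a semisimple Hopf algebra in characteristic zero is an
involution. -/
theorem antipode_antipode_of_semisimple {Λ : H} (hΛ : IsNormalizedHopfIntegral K H Λ) (x : H) :
    antipode K (antipode K x) = x := by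
  obtain ⟨hL, hn⟩ := hΛ
  have hR := hL.right
  have hnt : Nontrivial H := by
    refine ⟨0, 1, fun h => ?_⟩
    have := congr(counit (R := K) $h)
    simp at this
  have hn0 : (Module.finrank K H : K) ≠ 0 := by
    exact_mod_cast Module.finrank_pos.ne'
  obtain ⟨r, d, ρ, c, c', hsurj, hinj, hcc', hint, htr, hsnd, hfst, hnak⟩ :=
    exists_frobeniusForm (s := fun h => antipode K (antipode K h)) hn0 (tmul_one_mul_hopfNu hL)
      (hopfNu_mul_tmul_one hR) (by rw [mul_hopfNu, hn])
  set lam := weightedCharacter ρ c'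
  have hlam : IsDualForm Λ lam := ⟨hsnd, hfst, hnak⟩
  have hc'c (χ) : c' χ * c χ = 1 := mul_eq_one_comm.mp (hcc' χ)
  have hS : Function.Injective (antipode K (A := H)) := by
    rw [injective_iff_map_eq_zero]
    intro y hy
    refine hinj _ _ fun χ => ?_
    have := hint χ y
    rw [hy, map_zero, map_zero, zero_mul] at this
    rw [map_zero, ← one_mul (ρ χ y), ← hc'c, mul_assoc, this, mul_zero]
  obtain ⟨k, hk, hTk⟩ := hlam.exists_pow_eq_one hS hL hR
  have hχ : ∃ χ : Fin r, True := by
    by_contra hne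
    push Not at hne
    exact zero_ne_one (hinj (0 : H) 1 fun χ => (hne χ).elim)
  obtain ⟨χ₀, -⟩ := hχ
  -- `c_χ ^ k` intertwines `ρ_χ` with `ρ_χ ∘ S^(2k) = ρ_χ`, so it is scalar.
  have hck (χ) : ∃ s : K, s ≠ 0 ∧ c χ ^ k = s • 1 := by
    have hpow (j : ℕ) (h : H) : c χ ^ j * ρ χ h =
        ρ χ (((antipode K ∘ₗ antipode K (A := H) : Module.End K H) ^ j) h) * c χ ^ j := by
      induction j generalizing h with
      | zero => simp
      | succ j ih =>
        rw [pow_succ, mul_assoc, hint, ← mul_assoc, ih, mul_assoc,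
            pow_succ (antipode K ∘ₗ antipode K (A := H))]
        rfl
    obtain ⟨s, hs⟩ := Matrix.exists_eq_smul_one_of_commute (M := c χ ^ k) fun N => by
      obtain ⟨h, rfl⟩ := hsurj χ N
      have := hpow k h
      rw [hTk] at this
      exact this.symm
    refine ⟨s, fun hs0 => hn0 ?_, hs⟩
    rw [hs0, zero_smul] at hs
    have h1 : (c χ) ^ k * (c' χ) ^ k = 1 := by
      rw [← Commute.mul_pow (show Commute (c χ) (c' χ) from (hcc' χ).trans (hc'c χ).symm), hcc',
        one_pow]
    rw [hs, zero_mul] at h1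
    rw [← htr χ, ← mul_one (c χ), ← h1, mul_zero, Matrix.trace_zero]
  -- Since every `tr(c_χ)` equals `n`, the sum `∑ tr(c_χ) tr(c_χ⁻¹)` is `n λ(1)`.
  have hTne : (Module.finrank K H : K) * lam 1 ≠ 0 := by
    have := sum_trace_mul_trace_inv_ne_zero hk hcc' hck (i₀ := χ₀) (by rw [htr]; exact hn0)
    simpa only [htr, ← Finset.mul_sum, lam, weightedCharacter_apply, map_one, mul_one] using this
  have hTE := hlam.trace_antipode_sq_regularProjection hR hn0 hn
  obtain ⟨z, hz⟩ := exists_eq_smul_of_trace hk hTk (isIdempotentElem_regularProjection hn0)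
    (commute_antipode_sq_regularProjection hS)
    (by rw [hTE, hlam.trace_antipode_sq, hn]) (by rw [hTE]; exact right_ne_zero_of_mul hTne)
  have h1 := congr($hz 1)
  simp only [LinearMap.comp_apply, antipode_one, LinearMap.smul_apply, Module.End.one_apply] at h1
  have hz1 : z = 1 := by
    have := congr(counit (R := K) $h1)
    simpa using this.symm
  simpa [hz1] using congr($hz x)

end AntipodeSquared

/-! ### Integrality from weak forms and the eigenvalue `n/d` -/

section WeakForms

open scoped TensorProduct

/-- Quotients of elements of an integrally closed subring that are integral over it belong to it. -/
theorem mem_of_isIntegral_of_mul_eq {K : Type u} [Field K] (R : Subring K) [IsIntegrallyClosed R]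
    {a b : R} (hb : b ≠ 0) {z : K} (hz : z * b = a) (hint : IsIntegral R z) : z ∈ R := by
  have hinj : Function.Injective (algebraMap R K) := Subtype.val_injective
  let f : FractionRing R →ₐ[R] K := IsFractionRing.liftAlgHom (g := Algebra.ofId R K) hinj
  have hb' : (b : K) ≠ 0 := fun h => hb (Subtype.ext h)
  have hf : f (algebraMap R _ a / algebraMap R _ b) = z := by
    rw [map_div₀, f.commutes, f.commutes]
    exact (eq_div_of_mul_eq hb' hz).symm
  rw [← hf, isIntegral_algHom_iff f f.toRingHom.injective] at hint
  obtain ⟨y, hy⟩ := IsIntegrallyClosed.isIntegral_iff.mp hint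
  rw [← hf, ← hy, f.commutes]
  exact y.2

/-- If left multiplication by `ν` has coefficients in `R`, then every eigenvalue of `ν` in a matrix
representation is integral over `R`. -/
theorem isIntegral_eigenvalue_of_leftMulMatrix {K : Type u} [Field K] (R : Subring K)
    {B : Type v} [Ring B] [Algebra K B] {ι : Type*} [Fintype ι] [DecidableEq ι]
    (b : Module.Basis ι K B) {ν : B} (hR : ∀ i j, b.repr (ν * b j) i ∈ R)
    {m : Type*} [Fintype m] [DecidableEq m] (ρ : B →ₐ[K] Matrix m m K) {z : K} {v : m → K}
    (hv : v ≠ 0) (hz : (ρ ν).mulVec v = z • v) : IsIntegral R z := by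
  let M : Matrix ι ι R := Matrix.of fun i j => ⟨_, hR i j⟩
  have hM : M.map (algebraMap R K) = Algebra.leftMulMatrix b ν := by
    ext i j
    rw [Algebra.leftMulMatrix_eq_repr_mul]
    rfl
  refine ⟨M.charpoly, M.charpoly_monic, ?_⟩
  -- Cayley–Hamilton for left multiplication by `ν`, transferred to `ν` itself because the regular
  -- representation is faithful.
  have h1 : Polynomial.aeval ν (M.charpoly.map (algebraMap R K)) = 0 := by
    apply Algebra.leftMulMatrix_injective b
    rw [← Polynomial.aeval_algHom_apply, ← Matrix.charpoly_map, hM, Matrix.aeval_self_charpoly,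
      map_zero]
  have h2 : Polynomial.aeval (Matrix.toLin' (ρ ν)) (M.charpoly.map (algebraMap R K)) = 0 := by
    have := congr(Matrix.toLinAlgEquiv' (ρ $h1))
    rw [map_zero, map_zero, ← Polynomial.aeval_algHom_apply] at this
    rw [← this]
    exact Polynomial.aeval_algHom_apply (Matrix.toLinAlgEquiv' (R := K) (n := m)).toAlgHom _ _
  have h3 := Module.End.aeval_apply_of_hasEigenvector (f := Matrix.toLin' (ρ ν)) (μ := z) (x := v)
    (p := M.charpoly.map (algebraMap R K))
    ⟨by rw [Module.End.mem_eigenspace_iff, Matrix.toLin'_apply, hz], hv⟩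
  rw [h2, LinearMap.zero_apply, Polynomial.eval_map] at h3
  exact (smul_eq_zero.mp h3.symm).resolve_right hv

variable {K : Type u} {H : Type v} [Field K] [Ring H] [HopfAlgebra K H]

theorem repr_hopfNu_mul_mem {R : Subring K} {Λ : H}
    {x : Module.Basis (Fin (Module.finrank K H)) K H}
    (hm : ∀ i j k, x.repr (x i * x j) k ∈ R)
    (hν : ∀ i j, (x.tensorProduct x).repr (hopfNu K H Λ) (i, j) ∈ R) (i j) :
    (x.tensorProduct x).repr (hopfNu K H Λ * x.tensorProduct x j) i ∈ R := by
  rw [← (x.tensorProduct x).sum_repr (hopfNu K H Λ), Finset.sum_mul, map_sum,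
    Finsupp.finsetSum_apply]
  refine sum_mem fun p _ => ?_
  rw [smul_mul_assoc, map_smul, Finsupp.smul_apply, smul_eq_mul]
  refine mul_mem (hν p.1 p.2) ?_
  rw [Module.Basis.tensorProduct_apply', Module.Basis.tensorProduct_apply',
    Algebra.TensorProduct.tmul_mul_tmul, Module.Basis.tensorProduct_repr_tmul_apply]
  exact mul_mem (hm _ _ _) (hm _ _ _)

/-- Irreducible representations over an algebraically closed field are surjective. -/
theorem exists_surjective_matrixRep [IsAlgClosed K] [FiniteDimensional K H]
    (M : Type w) [AddCommGroup M] [Module K M] [Module H M] [IsScalarTower K H M]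
    (hM : IsSimpleModule H M) :
    ∃ (d : ℕ) (ρ : H →ₐ[K] Matrix (Fin d) (Fin d) K),
      Module.finrank K M = d ∧ 0 < d ∧ Function.Surjective ρ := by
  have hfin : Module.Finite K M := Module.Finite.trans H M
  have hnt : Nontrivial M := IsSimpleModule.nontrivial H M
  let b := Module.finBasis K M
  have hdens : Function.Surjective (Algebra.lsmul K K M : H →ₐ[K] Module.End K M) := by
    intro f
    have hE := IsSimpleModule.algebraMap_end_bijective_of_isAlgClosed (A := H) (V := M) K
    have hfinE : Module.Finite (Module.End H M) M :=
      Module.Finite.of_restrictScalars_finite K (Module.End H M) M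
    -- By Schur's lemma `End_H(M) = K`, so every `K`-linear map lies in the bicommutant and the
    -- density theorem applies.
    let g : Module.End (Module.End H M) M :=
      { toFun := f
        map_add' := f.map_add
        map_smul' := fun φ y => by
          obtain ⟨z, rfl⟩ := hE.2 φ
          exact f.map_smul z y }
    obtain ⟨h, hh⟩ := Module.Finite.toModuleEnd_moduleEnd_surjective (R := H) (M := M) g
    exact ⟨h, LinearMap.ext fun y => congr($hh y)⟩
  exact ⟨_, (LinearMap.toMatrixAlgEquiv b).toAlgHom.comp (Algebra.lsmul K K M), rfl,
    Module.finrank_pos, (LinearMap.toMatrixAlgEquiv b).surjective.comp hdens⟩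

/-- `dim H / dim M` is an eigenvalue of `ν` on `M ⊗ M`. -/
theorem exists_eigenvector_hopfNu [IsAlgClosed K] [CharZero K] [FiniteDimensional K H]
    [IsSemisimpleRing H] {Λ : H} (hΛ : IsNormalizedHopfIntegral K H Λ) {d : ℕ} (hd : 0 < d)
    {ρ : H →ₐ[K] Matrix (Fin d) (Fin d) K} (hρ : Function.Surjective ρ) :
    ∃ v ≠ 0, (kroneckerRep ρ ρ (hopfNu K H Λ)).mulVec v = ((Module.finrank K H : K) / d) • v := by
  have : NeZero d := ⟨hd.ne'⟩
  have hL := hΛ.1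
  obtain ⟨c, hc⟩ := exists_kroneckerRep_eq (tmul_one_mul_hopfNu hL) hρ
  have hcomm := intertwine_of_kroneckerRep_eq (s := id) (fun h => by
    rw [hopfNu_mul_tmul_one hL.right, antipode_antipode_of_semisimple hΛ, id]) hc
  have htr := trace_of_kroneckerRep_eq (by rw [mul_hopfNu, hΛ.2]) hc
  obtain ⟨z, rfl⟩ := Matrix.exists_eq_smul_one_of_commute (M := c) fun N => by
    obtain ⟨h, rfl⟩ := hρ N
    exact (hcomm h).symm
  have hd0 : (d : K) ≠ 0 := by exact_mod_cast hd.ne'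
  have hz : z = (Module.finrank K H : K) / d := by
    rw [eq_div_iff hd0, ← htr]
    simp
  -- The vector `e₀ ⊗ e₀` is fixed by the flip, and `ν` acts as `z` times the flip.
  refine ⟨Pi.single (0, 0) 1, by simp, ?_⟩
  ext ⟨i, k⟩
  rw [← hz, Matrix.mulVec_single_one, Matrix.col_apply, hc]
  by_cases hi : i = 0 <;> by_cases hk : k = 0 <;> simp [hi, hk]

end WeakForms

theorem corollary3 (K : Type u) [Field K] [IsAlgClosed K] [CharZero K]
    (H : Type v) [Ring H] [HopfAlgebra K H] [FiniteDimensional K H] [IsSemisimpleRing H]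
    (ι : Type t) (R : ι → Subring K)
    (hUFD : ∀ i, UniqueFactorizationMonoid (R i))
    (hform : ∀ i, AdmitsWeakHopfForm K H (R i))
    (hint : (⋂ i, (R i : Set K)) ⊆ {a : K | IsIntegral ℤ a}) :
    IsFrobeniusType.{u, v, w} K H := by
  intro M _ _ _ _ hM
  obtain ⟨d, ρ, hdM, hd, hρ⟩ := exists_surjective_matrixRep (K := K) M hM
  rw [hdM]
  set n := Module.finrank K H
  have hd0 : (d : K) ≠ 0 := by exact_mod_cast hd.ne'
  have hmem : (n : K) / d ∈ ⋂ i, (R i : Set K) := by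
    refine Set.mem_iInter.mpr fun i => ?_
    obtain ⟨L, Λ, hΛ, x, -, hm, hν⟩ := hform i
    obtain ⟨v, hv0, hv⟩ := exists_eigenvector_hopfNu hΛ hd hρ
    have := hUFD i
    have hb : (d : R i) ≠ 0 := fun h => hd0 (by simpa using congr((R i).subtype $h))
    refine mem_of_isIntegral_of_mul_eq (R i) (a := n) (b := d) hb ?_
      (isIntegral_eigenvalue_of_leftMulMatrix (R i) (x.tensorProduct x)
        (repr_hopfNu_mul_mem hm hν) (kroneckerRep ρ ρ) hv0 hv)
    push_cast
    exact div_mul_cancel₀ _ hd0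
  -- Integrality descends from `K` to `ℚ`, where `ℤ` is integrally closed.
  have hq : IsIntegral ℤ ((n : ℚ) / d) := by
    rw [← isIntegral_algebraMap_iff (algebraMap ℚ K).injective]
    simpa using hint hmem
  obtain ⟨z, hz⟩ := IsIntegrallyClosed.isIntegral_iff.mp hq
  rw [eq_intCast, eq_div_iff (by exact_mod_cast hd.ne')] at hz
  have : (z * d : ℤ) = n := by exact_mod_cast hz
  exact Int.natCast_dvd_natCast.mp ⟨z, by rw [← this, mul_comm]⟩
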